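/- **Theorem 1 (compressed sensing from orthogonal array measurements).** A binary $M\times n$ orthogonal array of strength $t$ (where $t\le n$) is a sign matrix $O\in\{\pm1\}^{M\times n}$ such that, for every selection of $t$ distinct columns, all elements of $\{\pm1\}^t$ occur equally often among the $M$ rows restricted to these columns. There are absolute constants $C,\tilde c>0$ such that the following holds for all natural numbers $n\ge 4$, $s$, $m$, $M$ and every binary $M\times n$ orthogonal array $O$ of strength four. Suppose that $m\ge C\,s\log(2n)$ and let $A$ be the random $m\times n$ matrix whose $m$ rows are chosen independently and uniformly at random (with replacement) among the $M$ rows of $O$. Then, with probability at least $1-2e^{-\tilde c m}$, the matrix $A$ has the following property: every $s$-sparse $x\in\mathbb{C}^n$ (i.e. $x$ has at most $s$ nonzero entries) is the unique solution of $$\text{minimize } \|z\|_{\ell_1}=\sum_{i=1}^n|z_i| \text{ over } z\in\mathbb{C}^n \quad\text{subject to}\quad Az=y,\qquad\text{where } y=Ax .$$ -/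

import Mathlib

/-- A binary `M × n` array `O` with entries `±1` (the units of `ℤ`) is an orthogonal array of
strength `t` if, for every selection of `t` distinct columns, all elements of `{±1}^t` occur
equally often among the rows restricted to these columns. -/
def IsOrthogonalArray {M n : ℕ} (O : Matrix (Fin M) (Fin n) ℤˣ) (t : ℕ) : Prop :=
  ∀ c : Fin t → Fin n, Function.Injective c →
    ∃ l : ℕ, ∀ σ : Fin t → ℤˣ,
      (Finset.univ.filter fun k : Fin M => ∀ i, O k (c i) = σ i).card = l

/-- The complex `m × n` matrix whose `i`-th row is the row of `O` with index `r i`. -/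
def rowSelection {M n m : ℕ} (O : Matrix (Fin M) (Fin n) ℤˣ) (r : Fin m → Fin M) :
    Matrix (Fin m) (Fin n) ℂ :=
  Matrix.of fun i j => (((O (r i) j : ℤˣ) : ℤ) : ℂ)

/-- A vector is `s`-sparse if it has at most `s` nonzero entries. -/
def IsSparse {n : ℕ} (s : ℕ) (x : Fin n → ℂ) : Prop :=
  {i | x i ≠ 0}.ncard ≤ s

/-- The `ℓ₁`-norm on `ℂⁿ`. -/
noncomputable def l1Norm {n : ℕ} (z : Fin n → ℂ) : ℝ :=
  ∑ i, ‖z i‖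

/-- `z` is a solution of: minimize `‖z‖₁` subject to `A z = y`. -/
def IsL1Minimizer {m n : ℕ} (A : Matrix (Fin m) (Fin n) ℂ) (y : Fin m → ℂ)
    (z : Fin n → ℂ) : Prop :=
  A.mulVec z = y ∧ ∀ w : Fin n → ℂ, A.mulVec w = y → l1Norm z ≤ l1Norm w

/-- Uniform recovery: for every `s`-sparse `x`, the `ℓ₁`-minimization with data `y = A x` has
`x` as its one and only solution. -/
def RecoversSparse {m n : ℕ} (A : Matrix (Fin m) (Fin n) ℂ) (s : ℕ) : Prop :=
  ∀ x : Fin n → ℂ, IsSparse s x → ∀ z : Fin n → ℂ, IsL1Minimizer A (A.mulVec x) z ↔ z = x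

open Finset MeasureTheory ProbabilityTheory Matrix

/-! ### Recovery from a restricted injectivity property -/

/-! Only a lower bound on `‖A v‖` over finitely many integer vectors is needed, with no upper
isometry bound. If recovery fails, the kernel of `A` contains a nonzero real `u` with `‖u‖₁² ≤ 8 s
‖u‖₂²`. Maurey's empirical method writes `u / ‖u‖₁` as a mean of signed basis vectors and replaces
it by a sum `v` of `26 s` of them, keeping the form `‖A v‖² - (m/4) ‖v‖²` negative
(`exists_signedBasis_sum`).

For a fixed `v`, strength four gives a random row `a` the moments `E⟨a,v⟩² = ‖v‖²` and `E⟨a,v⟩⁴ ≤ 3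
‖v‖⁴`. For nonnegative independent summands, two such moments already give an exponential lower
tail: `‖A v‖² ≤ (m/4) ‖v‖²` has probability at most `exp (-m/12)` (`measureReal_sum_le_quarter`). A
union bound over the `(2n)^(26 s)` choices of signed basis vectors finishes the proof. -/

theorem recoversSparse_of_injOn_cone {m n : ℕ} (B : Matrix (Fin m) (Fin n) ℝ) (s : ℕ)
    (hB : ∀ u : Fin n → ℝ, B *ᵥ u = 0 → (∑ j, |u j|) ^ 2 ≤ 8 * s * ∑ j, u j ^ 2 → u = 0) :
    RecoversSparse (B.map ((↑) : ℝ → ℂ)) s := by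
  have key : ∀ x w : Fin n → ℂ, IsSparse s x →
      (B.map ((↑) : ℝ → ℂ)) *ᵥ w = (B.map ((↑) : ℝ → ℂ)) *ᵥ x →
      l1Norm w ≤ l1Norm x → w = x := by
    intro x w hx hA hle
    classical
    set z : Fin n → ℂ := w - x with hz
    have hAz : (B.map ((↑) : ℝ → ℂ)) *ᵥ z = 0 := by rw [hz, mulVec_sub, hA, sub_self]
    set S : Finset (Fin n) := univ.filter fun i => x i ≠ 0 with hS
    have hcard : S.card ≤ s := by
      have : {i | x i ≠ 0} = (S : Set (Fin n)) := by ext; simp [hS]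
      rw [IsSparse, this, Set.ncard_coe_finset] at hx
      exact hx
    have hcone : ∑ i, ‖z i‖ ≤ 2 * ∑ i ∈ S, ‖z i‖ := by
      have h1 : ∀ i, ‖x i‖ + ‖z i‖ ≤ ‖w i‖ + if i ∈ S then 2 * ‖z i‖ else 0 := by
        intro i
        by_cases hi : x i = 0
        · simp [hS, hi, hz]
        · have h2 : ‖x i‖ ≤ ‖w i‖ + ‖z i‖ := by
            have : x i = w i - z i := by simp [hz]
            rw [this]
            exact norm_sub_le _ _
          simp only [hS, mem_filter, mem_univ, true_and, ne_eq, hi, not_false_eq_true, if_true]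
          linarith
      have h3 := sum_le_sum fun i (_ : i ∈ univ) => h1 i
      rw [sum_add_distrib, sum_add_distrib, sum_ite_mem, univ_inter, ← mul_sum] at h3
      simp only [l1Norm] at hle
      linarith
    have hsq : (∑ i, ‖z i‖) ^ 2 ≤ 4 * s * ∑ i, ‖z i‖ ^ 2 := by
      have h1 : (∑ i ∈ S, ‖z i‖) ^ 2 ≤ S.card * ∑ i ∈ S, ‖z i‖ ^ 2 := sq_sum_le_card_mul_sum_sq
      have h2 : ∑ i ∈ S, ‖z i‖ ^ 2 ≤ ∑ i, ‖z i‖ ^ 2 :=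
        sum_le_sum_of_subset_of_nonneg (subset_univ _) fun _ _ _ => sq_nonneg _
      have h3 : (S.card : ℝ) * ∑ i ∈ S, ‖z i‖ ^ 2 ≤ s * ∑ i, ‖z i‖ ^ 2 := by gcongr
      calc (∑ i, ‖z i‖) ^ 2 ≤ (2 * ∑ i ∈ S, ‖z i‖) ^ 2 := by gcongr
        _ = 4 * (∑ i ∈ S, ‖z i‖) ^ 2 := by ring
        _ ≤ 4 * s * ∑ i, ‖z i‖ ^ 2 := by linarith
    have hre : B *ᵥ (fun j => (z j).re) = 0 := by
      funext i
      have := congrArg Complex.re (congrFun hAz i)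
      simpa [mulVec, dotProduct] using this
    have him : B *ᵥ (fun j => (z j).im) = 0 := by
      funext i
      have := congrArg Complex.im (congrFun hAz i)
      simpa [mulVec, dotProduct] using this
    have hnorm : ∑ i, ‖z i‖ ^ 2 = ∑ i, (z i).re ^ 2 + ∑ i, (z i).im ^ 2 := by
      rw [← sum_add_distrib]
      refine sum_congr rfl fun i _ => ?_
      rw [Complex.sq_norm, Complex.normSq_apply]
      ring
    have hre1 : (∑ i, |(z i).re|) ^ 2 ≤ (∑ i, ‖z i‖) ^ 2 := by
      gcongr with i; exact Complex.abs_re_le_norm _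
    have him1 : (∑ i, |(z i).im|) ^ 2 ≤ (∑ i, ‖z i‖) ^ 2 := by
      gcongr with i; exact Complex.abs_im_le_norm _
    have hsum : ∑ i, ‖z i‖ ^ 2 = 0 := by
      have hs : (0 : ℝ) ≤ s := Nat.cast_nonneg s
      -- The real or imaginary part with the larger `ℓ₂` norm carries at least half of `‖z‖₂²`,
      -- which turns the cone constant 4 into 8.
      rcases le_total (∑ i, (z i).re ^ 2) (∑ i, (z i).im ^ 2) with h | h
      · have h0 : (fun j => (z j).im) = 0 := hB _ him (by nlinarith)
        have h1 : ∑ i, (z i).im ^ 2 = 0 := sum_eq_zero fun i _ => by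
          have : (z i).im = 0 := congrFun h0 i
          simp [this]
        have h2 : 0 ≤ ∑ i, (z i).re ^ 2 := sum_nonneg fun i _ => sq_nonneg _
        linarith
      · have h0 : (fun j => (z j).re) = 0 := hB _ hre (by nlinarith)
        have h1 : ∑ i, (z i).re ^ 2 = 0 := sum_eq_zero fun i _ => by
          have : (z i).re = 0 := congrFun h0 i
          simp [this]
        have h2 : 0 ≤ ∑ i, (z i).im ^ 2 := sum_nonneg fun i _ => sq_nonneg _
        linarith
    rw [sum_eq_zero_iff_of_nonneg fun i _ => sq_nonneg _] at hsum
    funext i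
    have : z i = 0 := by simpa using hsum i (mem_univ i)
    exact sub_eq_zero.mp this
  intro x hx z
  constructor
  · rintro ⟨h1, h2⟩
    exact key x z hx h1 (h2 x rfl)
  · rintro rfl
    refine ⟨rfl, fun w hw => ?_⟩
    by_contra! h
    exact h.ne (congrArg l1Norm (key z w hx hw h.le))

/-! ### Maurey's empirical method, derandomized -/

/-- The right side is the exact expectation of the form at `v` plus `r` independent draws from `p`,
so some outcome does not exceed it. The vector `v` collects the draws already fixed, and the
induction fixes one more each time by conditional expectation. -/
theorem exists_sum_bilin_le_average {ι E : Type*} [Fintype ι] [AddCommGroup E] [Module ℝ E]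
    (B : E →ₗ[ℝ] E →ₗ[ℝ] ℝ) (hB : ∀ x y, B x y = B y x) (p : ι → ℝ) (hp : ∀ i, 0 ≤ p i)
    (hp1 : ∑ i, p i = 1) (w : ι → E) (u : E) (hu : ∑ i, p i • w i = u) (r : ℕ) (v : E) :
    ∃ J : Fin r → ι, B (v + ∑ l, w (J l)) (v + ∑ l, w (J l)) ≤
      B v v + 2 * r * B v u + r * ∑ i, p i * B (w i) (w i) + r * (r - 1) * B u u := by
  induction r generalizing v with
  | zero => exact ⟨Fin.elim0, by simp⟩
  | succ r ih =>
    set q := ∑ i, p i * B (w i) (w i) with hq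
    have hlin : ∀ x, ∑ i, p i * B x (w i) = B x u := by
      intro x; rw [← hu]; simp
    have hlin' : ∑ i, p i * B (w i) u = B u u := by
      rw [← hlin u]; exact sum_congr rfl fun i _ => by rw [hB]
    obtain ⟨i, hi⟩ : ∃ i, B (v + w i) (v + w i) + 2 * r * B (v + w i) u + r * q
        + r * (r - 1) * B u u ≤ B v v + 2 * (r + 1 : ℕ) * B v u + (r + 1 : ℕ) * q
          + (r + 1 : ℕ) * ((r + 1 : ℕ) - 1) * B u u := by
      by_contra! h
      set T := B v v + 2 * (r + 1 : ℕ) * B v u + (r + 1 : ℕ) * q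
          + (r + 1 : ℕ) * ((r + 1 : ℕ) - 1) * B u u with hT
      have havg : ∑ i, p i * (B (v + w i) (v + w i) + 2 * r * B (v + w i) u + r * q
        + r * (r - 1) * B u u) = T := by
        have : ∀ i, p i * (B (v + w i) (v + w i) + 2 * r * B (v + w i) u + r * q
            + r * (r - 1) * B u u) = p i * (B v v + 2 * r * B v u + r * q + r * (r - 1) * B u u)
            + 2 * (p i * B v (w i)) + p i * B (w i) (w i) + 2 * r * (p i * B (w i) u) := by
          intro i
          simp only [map_add, LinearMap.add_apply, hB (w i) v]
          ring
        simp_rw [this, sum_add_distrib, ← sum_mul, ← mul_sum]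
        rw [hlin, hlin', hp1, ← hq, hT]
        push_cast
        ring
      obtain ⟨i, hi⟩ : ∃ i, 0 < p i := by
        by_contra! h0
        have := sum_nonpos fun i (_ : i ∈ univ) => h0 i
        linarith
      have : ∑ i, p i * T < T := by
        conv_rhs => rw [← havg]
        exact sum_lt_sum (fun i _ => mul_le_mul_of_nonneg_left (h i).le (hp i))
          ⟨i, mem_univ i, mul_lt_mul_of_pos_left (h i) hi⟩
      rw [← sum_mul, hp1, one_mul] at this
      exact this.false
    obtain ⟨J, hJ⟩ := ih (v + w i)
    refine ⟨Fin.cons i J, ?_⟩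
    simp only [Fin.sum_univ_succ, Fin.cons_zero, Fin.cons_succ, ← add_assoc]
    exact hJ.trans hi

/-- The standard basis vector indexed by the first component, with the sign given by the second. -/
def signedBasis {n : ℕ} (a : Fin n × Bool) : Fin n → ℝ :=
  Pi.single a.1 (if a.2 then 1 else -1)

/-- The form `‖A x‖² - (m/4) ‖x‖²` is `3m/4` at each signed basis vector and `-(m/4) ‖u‖₂² / L²` at
the mean `u / L`. The expectation `k · 3m/4 - k (k - 1) (m/4) ‖u‖₂² / L²` is negative exactly under
`hk`. -/
theorem exists_signedBasis_sum {m n : ℕ} (A : Matrix (Fin m) (Fin n) ℝ) (hm : 0 < m)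
    (hA : ∀ i j, A i j ^ 2 = 1) (k : ℕ) (u : Fin n → ℝ) (hu0 : A *ᵥ u = 0) (hu1 : u ≠ 0)
    (hk : 3 * (∑ j, |u j|) ^ 2 < (k - 1) * ∑ j, u j ^ 2) :
    ∃ J : Fin k → Fin n × Bool,
      ∑ i, (A *ᵥ ∑ l, signedBasis (J l)) i ^ 2 < m / 4 * ∑ j, (∑ l, signedBasis (J l)) j ^ 2 := by
  set L := ∑ j, |u j| with hL
  have hLpos : 0 < L := by
    obtain ⟨j, hj⟩ := Function.ne_iff.mp hu1
    exact sum_pos' (fun _ _ => abs_nonneg _) ⟨j, mem_univ j, abs_pos.mpr hj⟩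
  let B : (Fin n → ℝ) →ₗ[ℝ] (Fin n → ℝ) →ₗ[ℝ] ℝ :=
    LinearMap.mk₂ ℝ (fun x y => (A *ᵥ x) ⬝ᵥ (A *ᵥ y) - m / 4 * (x ⬝ᵥ y))
      (by intros; simp only [mulVec_add, add_dotProduct]; ring)
      (by intros; simp only [mulVec_smul, smul_dotProduct, smul_eq_mul]; ring)
      (by intros; simp only [mulVec_add, dotProduct_add]; ring)
      (by intros; simp only [mulVec_smul, dotProduct_smul, smul_eq_mul]; ring)
  have hBa : ∀ x y, B x y = (A *ᵥ x) ⬝ᵥ (A *ᵥ y) - m / 4 * (x ⬝ᵥ y) := fun _ _ => rfl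
  have hBsymm : ∀ x y, B x y = B y x := fun x y => by
    rw [hBa, hBa, dotProduct_comm, dotProduct_comm x]
  -- Sign `+` at `j` gets weight `(u j)⁺ / L` and sign `-` gets `(u j)⁻ / L`, so the mean is `u /
  -- L`.
  let p : Fin n × Bool → ℝ := fun a => (if a.2 then (u a.1)⁺ else (u a.1)⁻) / L
  have hp : ∀ a, 0 ≤ p a := by
    intro a
    refine div_nonneg ?_ hLpos.le
    split_ifs
    · exact posPart_nonneg _
    · exact negPart_nonneg _
  have hp1 : ∑ a, p a = 1 := by
    rw [Fintype.sum_prod_type]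
    simp only [p, Fintype.sum_bool, if_true, Bool.false_eq_true, if_false, ← add_div,
      posPart_add_negPart]
    rw [← sum_div, ← hL, div_self hLpos.ne']
  have hpu : ∑ a, p a • signedBasis a = L⁻¹ • u := by
    rw [Fintype.sum_prod_type]
    funext j
    simp only [p, Fintype.sum_bool, if_true, Bool.false_eq_true, if_false, Finset.sum_apply,
      Pi.add_apply, Pi.smul_apply, smul_eq_mul, signedBasis]
    rw [sum_eq_single j]
    · simp only [Pi.single_eq_same]
      conv_rhs => rw [← posPart_sub_negPart (u j)]
      ring
    · intro i _ hij
      simp [Pi.single_eq_of_ne hij.symm]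
    · simp
  have hBw : ∀ a : Fin n × Bool, B (signedBasis a) (signedBasis a) = 3 * m / 4 := by
    intro a
    have hsq : ((if a.2 then 1 else -1 : ℝ)) * (if a.2 then 1 else -1) = 1 := by
      split_ifs <;> norm_num
    have h1 : (A *ᵥ signedBasis a) ⬝ᵥ (A *ᵥ signedBasis a) = m := by
      have : ∀ i, (A *ᵥ signedBasis a) i * (A *ᵥ signedBasis a) i = 1 := by
        intro i
        simp only [mulVec, signedBasis, dotProduct_single]
        rw [mul_mul_mul_comm, hsq, ← sq, hA, one_mul]
      simp [dotProduct, this]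
    have h2 : signedBasis a ⬝ᵥ signedBasis a = 1 := by
      simp only [signedBasis, dotProduct_single, Pi.single_eq_same]
      exact hsq
    rw [hBa, h1, h2]
    ring
  obtain ⟨J, hJ⟩ := exists_sum_bilin_le_average B hBsymm p hp hp1 signedBasis _ hpu k 0
  refine ⟨J, ?_⟩
  have hBu : B (L⁻¹ • u) (L⁻¹ • u) = -(m / 4 * (L⁻¹ ^ 2 * ∑ j, u j ^ 2)) := by
    rw [hBa, mulVec_smul, hu0]
    simp only [smul_zero, zero_dotProduct, dotProduct_smul, smul_dotProduct, smul_eq_mul,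
      zero_sub, neg_inj]
    simp only [dotProduct, ← sq]
    ring
  have hk0 : k ≠ 0 := by
    rintro rfl
    have : 0 ≤ ∑ j, u j ^ 2 := sum_nonneg fun _ _ => sq_nonneg _
    push_cast at hk
    nlinarith
  have hneg : B (∑ l, signedBasis (J l)) (∑ l, signedBasis (J l)) < 0 := by
    simp only [zero_add, map_zero, LinearMap.zero_apply, mul_zero, hBw, ← sum_mul, hp1, one_mul,
      hBu] at hJ
    refine hJ.trans_lt ?_
    have hk' : 3 < (k - 1) * (L⁻¹ ^ 2 * ∑ j, u j ^ 2) := by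
      rw [inv_pow, mul_left_comm, ← div_eq_inv_mul, lt_div_iff₀ (by positivity)]
      exact hk
    have hkm : 0 < (k : ℝ) * (m / 4) := by positivity
    nlinarith [mul_lt_mul_of_pos_left hk' hkm]
  rw [hBa] at hneg
  simp only [dotProduct, ← sq] at hneg
  linarith

/-! ### Moments of orthogonal arrays of strength four -/

section OrthogonalArray

variable {M n : ℕ} {O : Matrix (Fin M) (Fin n) ℤˣ}

theorem IsOrthogonalArray.exists_sum_comp_eq {t : ℕ} (hO : IsOrthogonalArray O t)
    {c : Fin t → Fin n} (hc : Function.Injective c) (f : (Fin t → ℤˣ) → ℤ) :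
    ∃ l : ℕ, ∑ k, f (fun i => O k (c i)) = l * ∑ σ, f σ := by
  obtain ⟨l, hl⟩ := hO c hc
  refine ⟨l, ?_⟩
  rw [← sum_fiberwise univ (fun k i => O k (c i)), mul_sum]
  refine sum_congr rfl fun σ _ => ?_
  have : ∀ k ∈ univ.filter (fun k => (fun i => O k (c i)) = σ), f (fun i => O k (c i)) = f σ := by
    intro k hk
    rw [(mem_filter.mp hk).2]
  rw [sum_congr rfl this, sum_const, nsmul_eq_mul, ← hl σ]
  simp only [funext_iff]

theorem injective_vecCons_four {α : Type*} {a b c d : α} (hab : a ≠ b) (hac : a ≠ c) (had : a ≠ d)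
    (hbc : b ≠ c) (hbd : b ≠ d) (hcd : c ≠ d) : Function.Injective ![a, b, c, d] := by
  intro i j hij
  fin_cases i <;> fin_cases j <;> simp_all

theorem IsOrthogonalArray.sum_mul_mul_mul_eq_zero (hO : IsOrthogonalArray O 4)
    {a b c d : Fin n} (hab : a ≠ b) (hac : a ≠ c) (had : a ≠ d)
    (hbc : b ≠ c) (hbd : b ≠ d) (hcd : c ≠ d) :
    ∑ k, (O k a : ℤ) * O k b * O k c * O k d = 0 := by
  obtain ⟨l, hl⟩ := hO.exists_sum_comp_eq (injective_vecCons_four hab hac had hbc hbd hcd)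
    fun σ => (σ 0 : ℤ) * σ 1 * σ 2 * σ 3
  have h0 : ∑ σ : Fin 4 → ℤˣ, (σ 0 : ℤ) * σ 1 * σ 2 * σ 3 = 0 := by decide
  simpa [h0] using hl

theorem IsOrthogonalArray.sum_mul_eq_zero (hO : IsOrthogonalArray O 4) (hn : 4 ≤ n)
    {a b : Fin n} (hab : a ≠ b) : ∑ k, (O k a : ℤ) * O k b = 0 := by
  -- Two spare columns, available since `4 ≤ n`, complete the pair to four distinct ones, where the
  -- strength applies.
  obtain ⟨c, hc⟩ : ∃ c, c ∉ ({a, b} : Finset (Fin n)) := by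
    by_contra! h
    have := card_le_card fun x (_ : x ∈ univ) => h x
    have := this.trans card_le_two
    simp at this
    omega
  obtain ⟨d, hd⟩ : ∃ d, d ∉ ({a, b, c} : Finset (Fin n)) := by
    by_contra! h
    have := card_le_card fun x (_ : x ∈ univ) => h x
    have := this.trans card_le_three
    simp at this
    omega
  simp only [mem_insert, mem_singleton, not_or] at hc hd
  obtain ⟨l, hl⟩ := hO.exists_sum_comp_eq (injective_vecCons_four hab (Ne.symm hc.1)
    (Ne.symm hd.1) (Ne.symm hc.2) (Ne.symm hd.2.1) (Ne.symm hd.2.2))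
    fun σ => (σ 0 : ℤ) * σ 1
  have h0 : ∑ σ : Fin 4 → ℤˣ, (σ 0 : ℤ) * σ 1 = 0 := by decide
  simpa [h0] using hl

/-- The array `O` as a real matrix. -/
def realArray (O : Matrix (Fin M) (Fin n) ℤˣ) : Matrix (Fin M) (Fin n) ℝ :=
  Matrix.of fun k j => ((O k j : ℤ) : ℝ)

theorem realArray_sq (k : Fin M) (j : Fin n) : realArray O k j ^ 2 = 1 := by
  rcases Int.units_eq_one_or (O k j) with h | h <;> simp [realArray, h]

theorem IsOrthogonalArray.sum_realArray_mul (hO : IsOrthogonalArray O 4) (hn : 4 ≤ n)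
    (a b : Fin n) : ∑ k, realArray O k a * realArray O k b = if a = b then (M : ℝ) else 0 := by
  split_ifs with h
  · subst h
    simp [← sq, realArray_sq]
  · simp only [realArray, Matrix.of_apply]
    exact_mod_cast hO.sum_mul_eq_zero hn h

theorem IsOrthogonalArray.sum_sq_mulVec (hO : IsOrthogonalArray O 4) (hn : 4 ≤ n)
    (v : Fin n → ℝ) : ∑ k, (realArray O *ᵥ v) k ^ 2 = M * ∑ j, v j ^ 2 := by
  calc ∑ k, (realArray O *ᵥ v) k ^ 2
      = ∑ k, ∑ a, ∑ b, v a * v b * (realArray O k a * realArray O k b) := by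
        refine sum_congr rfl fun k _ => ?_
        rw [sq, mulVec, dotProduct, sum_mul_sum]
        exact sum_congr rfl fun a _ => sum_congr rfl fun b _ => by ring
    _ = ∑ a, ∑ b, v a * v b * ∑ k, realArray O k a * realArray O k b := by
        rw [sum_comm]
        refine sum_congr rfl fun a _ => ?_
        rw [sum_comm]
        exact sum_congr rfl fun b _ => by rw [mul_sum]
    _ = M * ∑ j, v j ^ 2 := by
        simp only [hO.sum_realArray_mul hn, mul_ite, mul_zero, sum_ite_eq, mem_univ, if_true]
        rw [mul_sum]
        exact sum_congr rfl fun a _ => by ring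

/-- The row sum vanishes unless the indices match in pairs. Each perfect matching of `a, b, c, d`
contributes one nonnegative term on the right, so any one valid matching suffices; `a = b = c = d`
is counted three times, hence only an inequality. -/
theorem IsOrthogonalArray.mul_sum_le_pairings (hO : IsOrthogonalArray O 4) (hn : 4 ≤ n)
    (v : Fin n → ℝ) (a b c d : Fin n) :
    v a * v b * v c * v d *
        ∑ k, realArray O k a * realArray O k b * realArray O k c * realArray O k d ≤
      M * ((if a = b then v a ^ 2 else 0) * (if c = d then v c ^ 2 else 0) +
        (if a = c then v a ^ 2 else 0) * (if b = d then v b ^ 2 else 0) +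
        (if a = d then v a ^ 2 else 0) * (if b = c then v b ^ 2 else 0)) := by
  have hM : (0 : ℝ) ≤ M := Nat.cast_nonneg M
  have hsq : ∀ k j, realArray O k j * realArray O k j = 1 := fun k j => by
    rw [← sq, realArray_sq]
  have hnn : ∀ (p : Prop) [Decidable p] (x : Fin n), 0 ≤ if p then v x ^ 2 else 0 := by
    intro p _ x
    split_ifs <;> positivity
  have hrhs : ∀ (p q : Prop) [Decidable p] [Decidable q] (x y : Fin n),
      0 ≤ (if p then v x ^ 2 else 0) * (if q then v y ^ 2 else 0) :=
    fun p q _ _ x y => mul_nonneg (hnn p x) (hnn q y)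
  have hzero : ∑ k, realArray O k a * realArray O k b * realArray O k c * realArray O k d = 0 →
      v a * v b * v c * v d *
        ∑ k, realArray O k a * realArray O k b * realArray O k c * realArray O k d ≤
      M * ((if a = b then v a ^ 2 else 0) * (if c = d then v c ^ 2 else 0) +
        (if a = c then v a ^ 2 else 0) * (if b = d then v b ^ 2 else 0) +
        (if a = d then v a ^ 2 else 0) * (if b = c then v b ^ 2 else 0)) := by
    intro h
    rw [h, mul_zero]
    exact mul_nonneg hM (add_nonneg (add_nonneg (hrhs _ _ _ _) (hrhs _ _ _ _)) (hrhs _ _ _ _))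
  have hpair : ∀ x y z w : Fin n, x = y →
      (∀ k, realArray O k a * realArray O k b * realArray O k c * realArray O k d =
        realArray O k x * realArray O k y * (realArray O k z * realArray O k w)) →
      v a * v b * v c * v d = v x * v y * (v z * v w) →
      M * ((if x = y then v x ^ 2 else 0) * (if z = w then v z ^ 2 else 0)) ≤
        M * ((if a = b then v a ^ 2 else 0) * (if c = d then v c ^ 2 else 0) +
        (if a = c then v a ^ 2 else 0) * (if b = d then v b ^ 2 else 0) +
        (if a = d then v a ^ 2 else 0) * (if b = c then v b ^ 2 else 0)) →
      v a * v b * v c * v d *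
        ∑ k, realArray O k a * realArray O k b * realArray O k c * realArray O k d ≤
      M * ((if a = b then v a ^ 2 else 0) * (if c = d then v c ^ 2 else 0) +
        (if a = c then v a ^ 2 else 0) * (if b = d then v b ^ 2 else 0) +
        (if a = d then v a ^ 2 else 0) * (if b = c then v b ^ 2 else 0)) := by
    rintro x y z w rfl hk hv hle
    refine le_trans (le_of_eq ?_) hle
    simp only [hk, hv, hsq, one_mul, hO.sum_realArray_mul hn, if_true]
    by_cases hzw : z = w
    · subst hzw
      simp only [if_true]
      ring
    · simp [hzw]
  by_cases hab : a = b
  · exact hpair a b c d hab (fun k => by ring) (by ring) (mul_le_mul_of_nonneg_left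
      (by linarith [hrhs (a = c) (b = d) a b, hrhs (a = d) (b = c) a b]) hM)
  by_cases hac : a = c
  · exact hpair a c b d hac (fun k => by ring) (by ring) (mul_le_mul_of_nonneg_left
      (by linarith [hrhs (a = b) (c = d) a c, hrhs (a = d) (b = c) a b]) hM)
  by_cases had : a = d
  · exact hpair a d b c had (fun k => by ring) (by ring) (mul_le_mul_of_nonneg_left
      (by linarith [hrhs (a = b) (c = d) a c, hrhs (a = c) (b = d) a b]) hM)
  apply hzero
  by_cases hbc : b = c
  · subst hbc
    rw [← (hO.sum_realArray_mul hn a d).trans (if_neg had)]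
    exact sum_congr rfl fun k _ => by rw [mul_assoc (realArray O k a), hsq, mul_one]
  by_cases hbd : b = d
  · subst hbd
    rw [← (hO.sum_realArray_mul hn a c).trans (if_neg hac)]
    exact sum_congr rfl fun k _ => by rw [mul_right_comm, mul_assoc (realArray O k a), hsq, mul_one]
  by_cases hcd : c = d
  · subst hcd
    rw [← (hO.sum_realArray_mul hn a b).trans (if_neg hab)]
    exact sum_congr rfl fun k _ => by rw [mul_assoc, hsq, mul_one]
  simp only [realArray, Matrix.of_apply]
  exact_mod_cast hO.sum_mul_mul_mul_eq_zero hab hac had hbc hbd hcd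

theorem IsOrthogonalArray.sum_pow_four_mulVec_le (hO : IsOrthogonalArray O 4) (hn : 4 ≤ n)
    (v : Fin n → ℝ) : ∑ k, (realArray O *ᵥ v) k ^ 4 ≤ 3 * M * (∑ j, v j ^ 2) ^ 2 := by
  calc ∑ k, (realArray O *ᵥ v) k ^ 4
      = ∑ k, ∑ a, ∑ b, ∑ c, ∑ d, v a * v b * v c * v d *
          (realArray O k a * realArray O k b * realArray O k c * realArray O k d) := by
        refine sum_congr rfl fun k _ => ?_
        have : ∀ x : ℝ, x ^ 4 = x * (x * (x * x)) := fun x => by ring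
        rw [this, mulVec, dotProduct]
        simp only [sum_mul, mul_sum]
        exact sum_congr rfl fun a _ => sum_congr rfl fun b _ => sum_congr rfl fun c _ =>
          sum_congr rfl fun d _ => by ring
    _ = ∑ a, ∑ b, ∑ c, ∑ d, v a * v b * v c * v d *
          ∑ k, realArray O k a * realArray O k b * realArray O k c * realArray O k d := by
        rw [sum_comm]
        refine sum_congr rfl fun a _ => ?_
        rw [sum_comm]
        refine sum_congr rfl fun b _ => ?_
        rw [sum_comm]
        refine sum_congr rfl fun c _ => ?_
        rw [sum_comm]
        exact sum_congr rfl fun d _ => by rw [mul_sum]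
    _ ≤ ∑ a, ∑ b, ∑ c, ∑ d,
          M * ((if a = b then v a ^ 2 else 0) * (if c = d then v c ^ 2 else 0) +
            (if a = c then v a ^ 2 else 0) * (if b = d then v b ^ 2 else 0) +
            (if a = d then v a ^ 2 else 0) * (if b = c then v b ^ 2 else 0)) :=
        sum_le_sum fun a _ => sum_le_sum fun b _ => sum_le_sum fun c _ => sum_le_sum fun d _ =>
          hO.mul_sum_le_pairings hn v a b c d
    _ = 3 * M * (∑ j, v j ^ 2) ^ 2 := by
        simp only [← mul_sum, sum_add_distrib, ← sum_mul, sum_ite_eq, mem_univ, if_true]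
        ring

end OrthogonalArray

/-! ### Lower tail of sums of independent nonnegative variables -/

/-- Follows from `exp x ≥ 1 + x + x²/2` and `(1 + x + x²/2) (1 - x + x²/2) = 1 + x⁴/4 ≥ 1`. -/
theorem exp_neg_le_quadratic {x : ℝ} (hx : 0 ≤ x) : Real.exp (-x) ≤ 1 - x + x ^ 2 / 2 := by
  have h1 := Real.quadratic_le_exp_of_nonneg hx
  have h2 : 0 < 1 - x + x ^ 2 / 2 := by nlinarith [sq_nonneg (x - 1)]
  rw [Real.exp_neg, inv_le_comm₀ (Real.exp_pos _) h2]
  refine le_trans ?_ h1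
  rw [inv_le_iff_one_le_mul₀ h2]
  nlinarith [sq_nonneg (x ^ 2)]

theorem measureReal_sum_le_quarter {Ω : Type*} [MeasurableSpace Ω] {P : Measure Ω}
    [IsProbabilityMeasure P] {M m : ℕ} {r : Fin m → Ω → Fin M} (hM : M ≠ 0)
    (hr : ∀ i, Measurable (r i)) (hind : iIndepFun r P)
    (hunif : ∀ i k, P {ω | r i ω = k} = (M : ENNReal)⁻¹) (g : Fin M → ℝ) (hg : ∀ k, 0 ≤ g k)
    {σ : ℝ} (hσ : 0 < σ) (h1 : ∑ k, g k = M * σ) (h2 : ∑ k, g k ^ 2 ≤ 3 * M * σ ^ 2) :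
    P.real {ω | ∑ i, g (r i ω) ≤ m / 4 * σ} ≤ Real.exp (-(m / 12)) := by
  have hM' : (0 : ℝ) < M := by positivity
  have hgm : ∀ i, Measurable (fun ω => g (r i ω)) := fun i =>
    (measurable_of_finite g).comp (hr i)
  -- With `t = -θ/σ` the moment generating function is at most `1 - θ + 3θ²/2`, minimal at `θ = 1/3`
  -- with value `1 - 1/6`. The Chernoff exponent is then `m/12 - m/6`.
  set t : ℝ := -(1 / (3 * σ)) with ht
  have htneg : t ≤ 0 := by rw [ht, neg_nonpos]; positivity
  have hmgf : ∀ i, mgf (fun ω => g (r i ω)) P t ≤ Real.exp (-(1 / 6)) := by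
    intro i
    have : IsProbabilityMeasure (P.map (r i)) :=
      Measure.isProbabilityMeasure_map (hr i).aemeasurable
    have hmap : ∀ k, (P.map (r i)).real {k} = (M : ℝ)⁻¹ := by
      intro k
      rw [measureReal_def, Measure.map_apply (hr i) (measurableSet_singleton k)]
      have : r i ⁻¹' {k} = {ω | r i ω = k} := rfl
      rw [this, hunif]
      simp
    have hint : mgf (fun ω => g (r i ω)) P t = (M : ℝ)⁻¹ * ∑ k, Real.exp (t * g k) := by
      rw [mgf, ← integral_map (φ := r i) (f := fun k => Real.exp (t * g k)) (hr i).aemeasurable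
        (measurable_of_finite _).aestronglyMeasurable, integral_fintype Integrable.of_finite]
      simp only [hmap, smul_eq_mul, ← mul_sum]
    have hexp : ∀ k, Real.exp (t * g k) ≤ 1 - g k / (3 * σ) + g k ^ 2 / (18 * σ ^ 2) := by
      intro k
      have h := exp_neg_le_quadratic (div_nonneg (hg k) (by positivity : 0 ≤ 3 * σ))
      have e1 : t * g k = -(g k / (3 * σ)) := by rw [ht]; ring
      have e2 : (g k / (3 * σ)) ^ 2 / 2 = g k ^ 2 / (18 * σ ^ 2) := by
        rw [div_pow, div_div]; ring
      rwa [← e1, e2] at h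
    have hsum : ∑ k, Real.exp (t * g k) ≤ M * (1 - 1 / 6) := by
      refine (sum_le_sum fun k _ => hexp k).trans ?_
      rw [sum_add_distrib, sum_sub_distrib, ← sum_div, ← sum_div, h1]
      have e1 : (M : ℝ) * σ / (3 * σ) = M / 3 := by field_simp
      have e2 : (∑ k, g k ^ 2) / (18 * σ ^ 2) ≤ M / 6 := by
        rw [div_le_iff₀ (by positivity)]
        linarith
      rw [e1]
      simp only [sum_const, card_univ, Fintype.card_fin, nsmul_eq_mul, mul_one]
      linarith
    rw [hint, inv_mul_le_iff₀ hM']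
    refine hsum.trans (mul_le_mul_of_nonneg_left ?_ hM'.le)
    linarith [Real.add_one_le_exp (-(1 / 6) : ℝ)]
  have hsumm : Measurable (∑ i, fun ω => g (r i ω)) :=
    by
    have := Finset.measurable_sum univ fun i (_ : i ∈ univ) => hgm i
    convert this using 1
    ext ω
    simp
  have hnn : ∀ ω, 0 ≤ (∑ i, fun ω => g (r i ω)) ω := fun ω => by
    rw [Finset.sum_apply]
    exact sum_nonneg fun i _ => hg _
  have hint : Integrable (fun ω => Real.exp (t * (∑ i, fun ω => g (r i ω)) ω)) P := by
    refine Integrable.of_bound (C := 1) (by fun_prop) (ae_of_all _ fun ω => ?_)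
    rw [Real.norm_eq_abs, Real.abs_exp, Real.exp_le_one_iff]
    exact mul_nonpos_of_nonpos_of_nonneg htneg (hnn ω)
  have hind' : iIndepFun (fun i ω => g (r i ω)) P :=
    hind.comp (fun _ => g) fun _ => measurable_of_finite g
  have hch := measure_le_le_exp_mul_mgf (m / 4 * σ) htneg hint
  rw [hind'.mgf_sum hgm] at hch
  simp only [Finset.sum_apply] at hch
  refine hch.trans ?_
  calc Real.exp (-t * (m / 4 * σ)) * ∏ i, mgf (fun ω => g (r i ω)) P t
      ≤ Real.exp (-t * (m / 4 * σ)) * ∏ _i : Fin m, Real.exp (-(1 / 6)) :=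
        mul_le_mul_of_nonneg_left (prod_le_prod (fun _ _ => mgf_nonneg) fun i _ => hmgf i)
          (Real.exp_pos _).le
    _ = Real.exp (-(m / 12)) := by
        rw [prod_const, card_univ, Fintype.card_fin, ← Real.exp_nat_mul, ← Real.exp_add]
        congr 1
        rw [ht]
        field_simp
        ring

/-! ### Uniform recovery -/

theorem rowSelection_eq_map {M n m : ℕ} (O : Matrix (Fin M) (Fin n) ℤˣ) (r : Fin m → Fin M) :
    rowSelection O r = ((realArray O).submatrix r id).map ((↑) : ℝ → ℂ) := by
  ext i j
  simp [rowSelection, realArray]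

theorem recoversSparse_rowSelection {M n m : ℕ} (O : Matrix (Fin M) (Fin n) ℤˣ)
    (r : Fin m → Fin M) (hm : 0 < m) {s : ℕ} (hs : 0 < s)
    (h : ∀ J : Fin (26 * s) → Fin n × Bool, 0 < ∑ j, (∑ l, signedBasis (J l)) j ^ 2 →
      m / 4 * ∑ j, (∑ l, signedBasis (J l)) j ^ 2 <
        ∑ i, (realArray O *ᵥ ∑ l, signedBasis (J l)) (r i) ^ 2) :
    RecoversSparse (rowSelection O r) s := by
  rw [rowSelection_eq_map]
  refine recoversSparse_of_injOn_cone _ s fun u hu hcone => ?_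
  by_contra hu0
  have hs' : (1 : ℝ) ≤ s := by exact_mod_cast hs
  have hpos : 0 < ∑ j, u j ^ 2 := by
    obtain ⟨j, hj⟩ := Function.ne_iff.mp hu0
    exact sum_pos' (fun _ _ => sq_nonneg _) ⟨j, mem_univ j, by simpa using sq_pos_of_ne_zero hj⟩
  -- The cone gives `3 ‖u‖₁² ≤ 24 s ‖u‖₂²`, and `24 s < 26 s - 1` because `s ≥ 1`.
  obtain ⟨J, hJ⟩ := exists_signedBasis_sum ((realArray O).submatrix r id) hm
    (fun i j => realArray_sq _ _) (26 * s) u hu hu0 (by push_cast; nlinarith)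
  have hJ' : ∑ i, (realArray O *ᵥ ∑ l, signedBasis (J l)) (r i) ^ 2 <
      m / 4 * ∑ j, (∑ l, signedBasis (J l)) j ^ 2 := hJ
  have hm' : (0 : ℝ) < m / 4 := by positivity
  have hv : 0 < ∑ j, (∑ l, signedBasis (J l)) j ^ 2 :=
    pos_of_mul_pos_right ((sum_nonneg fun i _ => sq_nonneg _).trans_lt hJ') hm'.le
  exact (h J hv).asymm hJ'

theorem theorem1 :
    ∃ C c : ℝ, 0 < C ∧ 0 < c ∧
      ∀ (n s m M : ℕ), 4 ≤ n →
      ∀ O : Matrix (Fin M) (Fin n) ℤˣ, IsOrthogonalArray O 4 →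
      C * s * Real.log (2 * n) ≤ m →
      ∀ (Ω : Type*) [MeasurableSpace Ω] (P : MeasureTheory.Measure Ω)
        [MeasureTheory.IsProbabilityMeasure P] (r : Fin m → Ω → Fin M),
        (∀ i, Measurable (r i)) →
        ProbabilityTheory.iIndepFun r P →
        (∀ i k, P {ω | r i ω = k} = (M : ENNReal)⁻¹) →
        1 - 2 * Real.exp (-c * m) ≤
          P.real {ω | RecoversSparse (rowSelection O fun i => r i ω) s} := by
  -- As `624 = 26 · 24`, the entropy `26 s log (2n)` is at most `m/24`, half of the exponent `m/12`.
  refine ⟨624, 1 / 24, by norm_num, by norm_num, ?_⟩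
  intro n s m M hn O hO hm Ω _ P _ r hr hind hunif
  have hlog : 0 < Real.log (2 * n) := Real.log_pos (by
    have : (4 : ℝ) ≤ n := by exact_mod_cast hn
    linarith)
  have hn0 : (0 : ℝ) < 2 * n := by positivity
  rcases Nat.eq_zero_or_pos s with rfl | hs
  · have : {ω | RecoversSparse (rowSelection O fun i => r i ω) 0} = Set.univ := by
      refine Set.eq_univ_of_forall fun ω => ?_
      rw [Set.mem_ofPred_eq, rowSelection_eq_map]
      refine recoversSparse_of_injOn_cone _ 0 fun u _ hu => ?_
      have h0 : ∑ j, |u j| = 0 := by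
        simpa using le_antisymm (by simpa using hu) (sq_nonneg (∑ j, |u j|))
      funext j
      simpa using (sum_eq_zero_iff_of_nonneg fun j _ => abs_nonneg (u j)).mp h0 j (mem_univ j)
    rw [this, probReal_univ]
    linarith [Real.exp_pos (-(1 / 24) * (m : ℝ))]
  have hm0 : 0 < m := by
    have : (0 : ℝ) < m := lt_of_lt_of_le (by positivity) hm
    exact_mod_cast this
  have hM : M ≠ 0 := by
    rintro rfl
    obtain ⟨ω⟩ : Nonempty Ω := nonempty_of_isProbabilityMeasure P
    exact (r ⟨0, hm0⟩ ω).elim0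
  -- Signed basis vectors may cancel to `v = 0`, where the tail inequality holds trivially; such `J`
  -- are excluded.
  let bad : (Fin (26 * s) → Fin n × Bool) → Set Ω := fun J =>
    {ω | 0 < ∑ j, (∑ l, signedBasis (J l)) j ^ 2 ∧
      ∑ i, (realArray O *ᵥ ∑ l, signedBasis (J l)) (r i ω) ^ 2 ≤
        m / 4 * ∑ j, (∑ l, signedBasis (J l)) j ^ 2}
  have hbad : ∀ J, P.real (bad J) ≤ Real.exp (-(m / 12)) := by
    intro J
    by_cases hv : 0 < ∑ j, (∑ l, signedBasis (J l)) j ^ 2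
    · refine (measureReal_mono fun ω hω => hω.2).trans
        (measureReal_sum_le_quarter hM hr hind hunif
          (fun k => (realArray O *ᵥ ∑ l, signedBasis (J l)) k ^ 2) (fun k => sq_nonneg _) hv
          (hO.sum_sq_mulVec hn _) ?_)
      simp only [← pow_mul]
      exact hO.sum_pow_four_mulVec_le hn _
    · have : bad J = ∅ := Set.eq_empty_of_forall_notMem fun ω hω => hv hω.1
      rw [this, measureReal_empty]
      positivity
  have hcover : (Set.univ : Set Ω) ⊆
      {ω | RecoversSparse (rowSelection O fun i => r i ω) s} ∪ ⋃ J, bad J := by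
    intro ω _
    by_contra hω
    rw [Set.mem_union, not_or, Set.mem_iUnion] at hω
    refine hω.1 (recoversSparse_rowSelection O _ hm0 hs fun J hJ => ?_)
    by_contra! h
    exact hω.2 ⟨J, hJ, h⟩
  have hunion : P.real (⋃ J, bad J) ≤ Real.exp (-(1 / 24) * m) := by
    calc P.real (⋃ J, bad J) ≤ ∑ J, P.real (bad J) := measureReal_iUnion_fintype_le _
      _ ≤ ∑ _J : Fin (26 * s) → Fin n × Bool, Real.exp (-(m / 12)) :=
        sum_le_sum fun J _ => hbad J
      _ = (2 * n : ℝ) ^ (26 * s) * Real.exp (-(m / 12)) := by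
        simp [mul_comm]
      _ = Real.exp ((26 * s : ℕ) * Real.log (2 * n) + -(m / 12)) := by
        rw [Real.exp_add, Real.exp_nat_mul, Real.exp_log hn0]
      _ ≤ Real.exp (-(1 / 24) * m) := by
        apply Real.exp_le_exp.mpr
        push_cast
        linarith
  have htotal := (measureReal_mono hcover).trans (measureReal_union_le (μ := P) _ _)
  rw [probReal_univ] at htotal
  linarith [Real.exp_pos (-(1 / 24) * (m : ℝ))]
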